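/- Let $X$ be a real or complex Banach space, canonically embedded in its bidual $X^{**}$. For bounded $A\subset X$ put $$\omega(A)=\inf\Bigl\{\sup_{a\in A}\operatorname{dist}(a,K):\ \emptyset\ne K\subset X\text{ weakly compact}\Bigr\},\qquad \mathrm{wck}(A)=\sup\bigl\{\operatorname{dist}(\mathrm{clu}(x_n),X):\ (x_n)\text{ a sequence in }A\bigr\},$$ where $\mathrm{clu}(x_n)\subset X^{**}$ is the set of weak$^*$-cluster points of $(x_n)$ and $\operatorname{dist}(\mathrm{clu}(x_n),X)=\inf\{\|F-x\|:F\in\mathrm{clu}(x_n),\,x\in X\}$ (both quantities are $0$ for $A=\emptyset$). Consider the following properties of $X$. (I) $\mathrm{wck}(A)=\omega(A)$ for every bounded set $A\subset X$. (II) For every bounded set $A\subset X$ and every $\varepsilon>0$ there is a countable set $C\subset A$, infinite if $A$ is infinite, such that $\omega(C')>\omega(A)-\varepsilon$ for every infinite $C'\subset C$. The space $X$ has the subsequence splitting property if for every bounded sequence $(x_n)$ in $X$ and every $\varepsilon>0$ there is a subsequence $(x_{n_k})$ which can be written as $x_{n_k}=y_k+z_k$, where $(y_k)$ is weakly convergent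 in $X$ and $$\Bigl\|\sum_{j=1}^n\alpha_jz_j\Bigr\|\ge(1-\varepsilon)\sum_{j=1}^n|\alpha_j|\,\|z_j\|$$ for all $n\in\mathbb N$ and all scalars $\alpha_1,\dots,\alpha_n$. The space $X$ is L-embedded if there is a linear projection $P$ on $X^{**}$ with range $X$ such that $\|F\|=\|PF\|+\|F-PF\|$ for all $F\in X^{**}$. Then: (a) (I) implies (II). (b) If $X$ has the subsequence splitting property, then (II) implies (I). (c) If $X$ is L-embedded and satisfies (I), then $X$ has the subsequence splitting property. -/

import Mathlib

-- The value that Mathlib itself is compiled with; instances on the bidual need it.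
set_option maxSynthPendingDepth 3

open Filter Topology Set
open scoped ENNReal

namespace WeakNonCompactness

section Defs

variable (𝕜 : Type*) [RCLike 𝕜] {X : Type*} [NormedAddCommGroup X] [NormedSpace 𝕜 X]

/-- The excess `sup {dist(a, B) : a ∈ A}` of `A` over `B`, with values in `[0, ∞]`
(it is `∞` if `B` is empty and `A` is not). -/
noncomputable def excess (A B : Set X) : ℝ≥0∞ :=
  ⨆ a ∈ A, Metric.infEDist a B

/-- `K ⊆ X` is compact in the weak topology of `X`. -/
def IsWeaklyCompact (K : Set X) : Prop :=
  IsCompact (toWeakSpace 𝕜 X '' K)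

/-- The De Blasi measure of weak non-compactness
`ω(A) = inf {excess A K : K ⊆ X weakly compact}`. -/
noncomputable def deBlasi (A : Set X) : ℝ≥0∞ :=
  ⨅ (K : Set X) (_ : IsWeaklyCompact 𝕜 K), excess A K

/-- The bidual `X**`, with its norm. -/
abbrev Bidual (𝕜 : Type*) [RCLike 𝕜] (X : Type*) [NormedAddCommGroup X] [NormedSpace 𝕜 X] :
    Type _ :=
  StrongDual 𝕜 (StrongDual 𝕜 X)

/-- The canonical copy of `X` in `X**`. -/
def canonicalImage (𝕜 : Type*) [RCLike 𝕜] (X : Type*) [NormedAddCommGroup X]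
    [NormedSpace 𝕜 X] : Set (Bidual 𝕜 X) :=
  range (NormedSpace.inclusionInDoubleDual 𝕜 X)

/-- The set of all weak-star cluster points in `X**` of a sequence in `X`. -/
def weakStarClusterPts (x : ℕ → X) : Set (Bidual 𝕜 X) :=
  {F | MapClusterPt (StrongDual.toWeakDual F) atTop
    (fun n => StrongDual.toWeakDual (NormedSpace.inclusionInDoubleDual 𝕜 X (x n)))}

/-- The distance `dist(clu(x_n), X) = inf {dist(F, X) : F ∈ clu(x_n)}`, computed in `X**`. -/
noncomputable def clusterDist (x : ℕ → X) : ℝ≥0∞ :=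
  ⨅ F ∈ weakStarClusterPts 𝕜 x, Metric.infEDist F (canonicalImage 𝕜 X)

/-- `wck(A) = sup {dist(clu(x_n), X) : (x_n) a sequence in A}`. -/
noncomputable def wck (A : Set X) : ℝ≥0∞ :=
  ⨆ (x : ℕ → X) (_ : ∀ n, x n ∈ A), clusterDist 𝕜 x

/-- The sequence `y` converges in the weak topology to some element of `X`. -/
def IsWeaklyConvergent (y : ℕ → X) : Prop :=
  ∃ l : X, Tendsto (fun k => toWeakSpace 𝕜 X (y k)) atTop (𝓝 (toWeakSpace 𝕜 X l))

end Defs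

section Properties

variable (𝕜 : Type*) [RCLike 𝕜] (X : Type*) [NormedAddCommGroup X] [NormedSpace 𝕜 X]

/-- Property (I): `wck(A) = ω(A)` for every bounded set `A`. -/
def PropertyI : Prop :=
  ∀ A : Set X, Bornology.IsBounded A → wck 𝕜 A = deBlasi 𝕜 A

/-- Property (II): every bounded set `A` has, for each `ε > 0`, a countable subset `C` all of whose
infinite subsets `C'` satisfy `ω(C') > ω(A) - ε`. The set `C` is required to be infinite whenever
`A` is infinite, since the condition is void for a finite `C`. The inequality is written without
subtraction, as subtraction on `[0, ∞]` is truncated. -/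
def PropertyII : Prop :=
  ∀ A : Set X, Bornology.IsBounded A → ∀ ε : ℝ, 0 < ε →
    ∃ C : Set X, C ⊆ A ∧ C.Countable ∧ (A.Infinite → C.Infinite) ∧
      ∀ C' : Set X, C' ⊆ C → C'.Infinite →
        deBlasi 𝕜 A < deBlasi 𝕜 C' + ENNReal.ofReal ε

/-- The subsequence splitting property. -/
def SubsequenceSplitting : Prop :=
  ∀ x : ℕ → X, Bornology.IsBounded (range x) → ∀ ε : ℝ, 0 < ε →
    ∃ φ : ℕ → ℕ, StrictMono φ ∧ ∃ y z : ℕ → X,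
      (∀ k, x (φ k) = y k + z k) ∧ IsWeaklyConvergent 𝕜 y ∧
      ∀ (n : ℕ) (α : ℕ → 𝕜),
        (1 - ε) * ∑ j ∈ Finset.range n, ‖α j‖ * ‖z j‖ ≤ ‖∑ j ∈ Finset.range n, α j • z j‖

/-- `X` is L-embedded: there is a linear projection `P` on `X**` whose range is the canonical copy
of `X`, such that `‖F‖ = ‖P F‖ + ‖F - P F‖` for all `F`. -/
def IsLEmbedded : Prop :=
  ∃ P : Bidual 𝕜 X →ₗ[𝕜] Bidual 𝕜 X,
    (∀ F, P (P F) = P F) ∧ range P = canonicalImage 𝕜 X ∧ ∀ F, ‖F‖ = ‖P F‖ + ‖F - P F‖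

end Properties

end WeakNonCompactness

/-! A subsequence has fewer cluster points, hence larger `clusterDist`, and `wck ≤ deBlasi` always.
So the range of a sequence nearly attaining `wck A = deBlasi A` serves as `C` in (II).

For (b), suppose `wck A < deBlasi A` and split a sequence of distinct points of the set `C` from
(II) as `y + z`. Eventually `‖z k‖ ≥ ω(A) - ε`: otherwise infinitely many points of `C` would be
closer than that to the weakly compact set formed by `y` and its limit. By
`le_norm_sub_of_l1_lower_bound`, the `ℓ¹` bound then keeps all cluster points at distance at least
`(1 - ε)(ω(A) - ε) > wck A` from `X`.

For (c), either a diagonal subsequence converges weakly, or some subsequence has `ω` close to a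
constant `c > 0`. Property (I) gives a further subsequence whose cluster points have distance at
least `c - η` from `X`; subtracting nearby points `y` of a weakly compact set leaves `z` with norms
at most `c + η`. A weak-star limit `G` of `z` thus has norm and distance to `X` both close to `c`,
so by L-embeddedness `‖x + aG‖` is at least `‖x‖ + (c - 3η)|a|` (`IsLEmbedded.le_norm_add_smul`).
This estimate is passed down to a subsequence of `z` by `exists_l1_subseq`. -/

namespace WeakNonCompactness

open NormedSpace

/-! ### Limits along ultrafilters, comparison of the two measures, and (a). -/

section Limits

variable {𝕜 : Type*} [RCLike 𝕜] {X : Type*} [NormedAddCommGroup X] [NormedSpace 𝕜 X]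

theorem tendsto_toWeakSpace_iff {α : Type*} {l : Filter α} {y : α → X} {a : X} :
    Tendsto (fun k => toWeakSpace 𝕜 X (y k)) l (𝓝 (toWeakSpace 𝕜 X a)) ↔
      ∀ f : StrongDual 𝕜 X, Tendsto (fun k => f (y k)) l (𝓝 (f a)) := by
  refine WeakBilin.tendsto_iff_forall_eval_tendsto (topDualPairing 𝕜 X).flip ?_
  intro a b hab
  exact (SeparatingDual.eq_iff_forall_dual_eq (R := 𝕜)).2 fun g => LinearMap.congr_fun hab g

theorem mem_weakStarClusterPts_iff {x : ℕ → X} {F : Bidual 𝕜 X} :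
    F ∈ weakStarClusterPts 𝕜 x ↔ ∃ U : Ultrafilter ℕ, (U : Filter ℕ) ≤ atTop ∧
      ∀ f : StrongDual 𝕜 X, Tendsto (fun n => f (x n)) U (𝓝 (F f)) := by
  simp only [weakStarClusterPts, mem_ofPred_eq, mapClusterPt_iff_ultrafilter]
  refine exists_congr fun U => and_congr_right fun _ => ?_
  exact tendsto_iff_forall_eval_tendsto_topDualPairing

theorem exists_weakStar_limit {g : ℕ → StrongDual 𝕜 X} {r : ℝ} (hg : ∀ n, ‖g n‖ ≤ r)
    (U : Ultrafilter ℕ) :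
    ∃ G : StrongDual 𝕜 X, ‖G‖ ≤ r ∧ ∀ e, Tendsto (fun n => g n e) U (𝓝 (G e)) := by
  have hc := WeakDual.isCompact_closedBall (0 : StrongDual 𝕜 X) r
  obtain ⟨G, hG, hlim⟩ := hc.ultrafilter_le_nhds (U.map fun n => StrongDual.toWeakDual (g n))
    (le_principal_iff.2 <| Ultrafilter.mem_map.2 <| univ_mem' fun n => by
      simpa using hg n)
  refine ⟨WeakDual.toStrongDual G, by simpa using hG, fun e => ?_⟩
  exact tendsto_iff_forall_eval_tendsto_topDualPairing.1 hlim e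

theorem IsWeaklyCompact.exists_limit {K : Set X} (hK : IsWeaklyCompact 𝕜 K) {y : ℕ → X}
    {U : Ultrafilter ℕ} (hy : ∀ᶠ n in U, y n ∈ K) :
    ∃ l ∈ K, ∀ f : StrongDual 𝕜 X, Tendsto (fun n => f (y n)) U (𝓝 (f l)) := by
  obtain ⟨G, ⟨l, hl, rfl⟩, hlim⟩ := hK.ultrafilter_le_nhds (U.map fun n => toWeakSpace 𝕜 X (y n))
    (le_principal_iff.2 <| Ultrafilter.mem_map.2 <| hy.mono fun n hn => mem_image_of_mem _ hn)
  exact ⟨l, hl, tendsto_toWeakSpace_iff.1 hlim⟩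

theorem norm_le_of_weakStar_limit {α : Type*} {U : Filter α} [U.NeBot] {g : α → StrongDual 𝕜 X}
    {G : StrongDual 𝕜 X} {r : ℝ} (hg : ∀ᶠ n in U, ‖g n‖ ≤ r)
    (h : ∀ e, Tendsto (fun n => g n e) U (𝓝 (G e))) : ‖G‖ ≤ r := by
  obtain ⟨n, hn⟩ := hg.exists
  refine G.opNorm_le_bound ((norm_nonneg _).trans hn) fun e => ?_
  refine le_of_tendsto (h e).norm (hg.mono fun _ hn => ?_)
  exact ContinuousLinearMap.le_of_opNorm_le _ hn e

theorem norm_le_of_limit {α : Type*} {U : Filter α} [U.NeBot] {x : α → X}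
    {F : Bidual 𝕜 X} {r : ℝ} (hx : ∀ᶠ n in U, ‖x n‖ ≤ r)
    (h : ∀ f : StrongDual 𝕜 X, Tendsto (fun n => f (x n)) U (𝓝 (F f))) : ‖F‖ ≤ r :=
  norm_le_of_weakStar_limit (g := fun n => inclusionInDoubleDual 𝕜 X (x n))
    (hx.mono fun _ hn => (double_dual_bound 𝕜 X _).trans hn) h

theorem norm_inclusionInDoubleDual (x : X) : ‖inclusionInDoubleDual 𝕜 X x‖ = ‖x‖ :=
  (inclusionInDoubleDualLi 𝕜 (E := X)).norm_map x

theorem mem_canonicalImage (x : X) : inclusionInDoubleDual 𝕜 X x ∈ canonicalImage 𝕜 X :=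
  mem_range_self x

/-- Nearby points of `K` converge weakly along `U` to a point of `X`, and the norm of the difference
is weak-star lower semicontinuous. -/
theorem infEDist_le_of_limit {K : Set X} (hK : IsWeaklyCompact 𝕜 K) {x : ℕ → X}
    {U : Ultrafilter ℕ} {r : ℝ≥0∞} (hx : ∀ᶠ n in U, Metric.infEDist (x n) K < r)
    {F : Bidual 𝕜 X} (h : ∀ f : StrongDual 𝕜 X, Tendsto (fun n => f (x n)) U (𝓝 (F f))) :
    Metric.infEDist F (canonicalImage 𝕜 X) ≤ r := by
  rcases eq_or_ne r ∞ with rfl | hr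
  · exact le_top
  have hex : ∀ n, ∃ k, Metric.infEDist (x n) K < r → k ∈ K ∧ edist (x n) k < r := fun n => by
    by_cases hn : Metric.infEDist (x n) K < r
    · obtain ⟨k, hk⟩ := Metric.infEDist_lt_iff.1 hn
      exact ⟨k, fun _ => hk⟩
    · exact ⟨0, fun h => absurd h hn⟩
  choose k hk using hex
  obtain ⟨l, -, hl⟩ := hK.exists_limit (y := k) (hx.mono fun n hn => (hk n hn).1)
  refine (Metric.infEDist_le_edist_of_mem (mem_canonicalImage l)).trans ?_
  have hbd : ‖F - inclusionInDoubleDual 𝕜 X l‖ ≤ r.toReal := by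
    refine norm_le_of_limit (U := (U : Filter ℕ)) (x := fun n => x n - k n)
      (hx.mono fun n hn => ?_) fun f => ?_
    · have := (hk n hn).2
      rw [edist_dist, ← ENNReal.ofReal_toReal hr] at this
      rw [← dist_eq_norm]
      exact (ENNReal.lt_ofReal_iff_toReal_lt ENNReal.ofReal_ne_top).1 this |>.le |> fun h => by
        simpa [ENNReal.toReal_ofReal dist_nonneg] using h
    · simpa using (h f).sub (hl f)
  rw [edist_dist, dist_eq_norm]
  exact ENNReal.ofReal_le_of_le_toReal hbd

theorem infEDist_le_excess {A B : Set X} {a : X} (ha : a ∈ A) :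
    Metric.infEDist a B ≤ excess A B :=
  le_iSup₂ (f := fun a (_ : a ∈ A) => Metric.infEDist a B) a ha

theorem exists_excess_lt {A : Set X} {r : ℝ≥0∞} (h : deBlasi 𝕜 A < r) :
    ∃ K, IsWeaklyCompact 𝕜 K ∧ excess A K < r := by
  simpa [deBlasi, iInf_lt_iff] using h

theorem deBlasi_le {A K : Set X} (hK : IsWeaklyCompact 𝕜 K) : deBlasi 𝕜 A ≤ excess A K :=
  iInf₂_le K hK

theorem exists_cluster {x : ℕ → X} (hx : Bornology.IsBounded (range x)) {U : Ultrafilter ℕ} :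
    ∃ F : Bidual 𝕜 X, ∀ f : StrongDual 𝕜 X, Tendsto (fun n => f (x n)) U (𝓝 (F f)) := by
  obtain ⟨r, hr⟩ := hx.exists_norm_le
  obtain ⟨G, -, h⟩ := exists_weakStar_limit (g := fun n => inclusionInDoubleDual 𝕜 X (x n))
    (r := r) (fun n => (double_dual_bound 𝕜 X _).trans (hr _ (mem_range_self n))) U
  exact ⟨G, h⟩

theorem clusterDist_le {x : ℕ → X} {U : Ultrafilter ℕ} (hU : (U : Filter ℕ) ≤ atTop)
    {F : Bidual 𝕜 X} (h : ∀ f : StrongDual 𝕜 X, Tendsto (fun n => f (x n)) U (𝓝 (F f))) :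
    clusterDist 𝕜 x ≤ Metric.infEDist F (canonicalImage 𝕜 X) :=
  iInf₂_le (f := fun F (_ : F ∈ weakStarClusterPts 𝕜 x) =>
    Metric.infEDist F (canonicalImage 𝕜 X)) F (mem_weakStarClusterPts_iff.2 ⟨U, hU, h⟩)

theorem le_clusterDist {x : ℕ → X} {r : ℝ≥0∞}
    (h : ∀ (U : Ultrafilter ℕ) (F : Bidual 𝕜 X), (U : Filter ℕ) ≤ atTop →
      (∀ f : StrongDual 𝕜 X, Tendsto (fun n => f (x n)) U (𝓝 (F f))) →
      r ≤ Metric.infEDist F (canonicalImage 𝕜 X)) : r ≤ clusterDist 𝕜 x :=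
  le_iInf₂ fun _ hF => by
    obtain ⟨U, hU, hlim⟩ := mem_weakStarClusterPts_iff.1 hF
    exact h U _ hU hlim

theorem clusterDist_le_wck {A : Set X} {x : ℕ → X} (hx : ∀ n, x n ∈ A) :
    clusterDist 𝕜 x ≤ wck 𝕜 A :=
  le_iSup₂ (f := fun (x : ℕ → X) (_ : ∀ n, x n ∈ A) => clusterDist 𝕜 x) x hx

theorem clusterDist_le_comp (x : ℕ → X) {φ : ℕ → ℕ} (hφ : Tendsto φ atTop atTop) :
    clusterDist 𝕜 x ≤ clusterDist 𝕜 (x ∘ φ) :=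
  le_clusterDist fun U _ hU h =>
    clusterDist_le (U := U.map φ) ((map_mono hU).trans hφ) fun f => tendsto_map'_iff.2 (h f)

theorem wck_le_deBlasi {A : Set X} (hA : Bornology.IsBounded A) : wck 𝕜 A ≤ deBlasi 𝕜 A := by
  refine iSup₂_le fun x hx => le_of_forall_gt fun r hr => ?_
  obtain ⟨s, hs, hsr⟩ := exists_between hr
  obtain ⟨K, hK, hKs⟩ := exists_excess_lt hs
  obtain ⟨F, hF⟩ := exists_cluster (𝕜 := 𝕜) (hA.subset (range_subset_iff.2 hx))
    (U := hyperfilter ℕ)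
  refine ((clusterDist_le Nat.hyperfilter_le_atTop hF).trans ?_).trans_lt hsr
  exact infEDist_le_of_limit hK
    (Eventually.of_forall fun n => (infEDist_le_excess (hx n)).trans_lt hKs) hF

theorem clusterDist_eq_zero {x : ℕ → X} {a : X} (h : ∃ᶠ n in atTop, x n = a) :
    clusterDist 𝕜 x = 0 := by
  obtain ⟨φ, hφ, hx⟩ := extraction_of_frequently_atTop h
  refine le_antisymm ((clusterDist_le_comp x hφ.tendsto_atTop).trans ?_) zero_le
  refine (clusterDist_le (U := hyperfilter ℕ) (F := inclusionInDoubleDual 𝕜 X a)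
    Nat.hyperfilter_le_atTop fun f => ?_).trans
    (Metric.infEDist_zero_of_mem (mem_canonicalImage a)).le
  simp [hx]

theorem deBlasi_ne_top {A : Set X} (hA : Bornology.IsBounded A) : deBlasi 𝕜 A ≠ ∞ := by
  obtain ⟨r, hr⟩ := hA.exists_norm_le
  refine ((deBlasi_le (K := {0}) (by simp [IsWeaklyCompact])).trans
    (iSup₂_le (a := ENNReal.ofReal r) fun a ha => ?_)).trans_lt ENNReal.ofReal_lt_top |>.ne
  simpa [edist_dist] using ENNReal.ofReal_le_ofReal (hr a ha)

theorem infinite_range_of_clusterDist_ne_zero {x : ℕ → X} (h : clusterDist 𝕜 x ≠ 0) :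
    (range x).Infinite := by
  intro hfin
  have := hfin.to_subtype
  obtain ⟨a, ha⟩ := Finite.exists_infinite_fiber (rangeFactorization x)
  refine h (clusterDist_eq_zero (a := a) (Nat.frequently_atTop_iff_infinite.2 ?_))
  convert infinite_coe_iff.1 ha using 1
  ext n
  simp [rangeFactorization, Subtype.ext_iff]

theorem PropertyI.propertyII (hI : PropertyI 𝕜 X) : PropertyII 𝕜 X := by
  intro A hA ε hε
  have hε' : ENNReal.ofReal ε ≠ 0 := by simpa using hε
  by_cases hfin : A.Finite
  · exact ⟨A, Subset.rfl, hfin.countable, fun h => absurd hfin h,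
      fun C' hC' hinf => absurd (hfin.subset hC') hinf⟩
  have hinf : A.Infinite := hfin
  -- If `ω(A) < ε`, any countably infinite subset works; otherwise the truncated difference `ω(A) -
  -- ε` is a true one.
  rcases lt_or_ge (deBlasi 𝕜 A) (ENNReal.ofReal ε) with hlt | hge
  · let e := hinf.natEmbedding
    refine ⟨range fun n => (e n : X), range_subset_iff.2 fun n => (e n).2, countable_range _,
      fun _ => infinite_range_of_injective (Subtype.val_injective.comp e.injective),
      fun C' _ _ => hlt.trans_le le_add_self⟩
  · have hpos : deBlasi 𝕜 A ≠ 0 := fun h0 => hε' (le_antisymm (h0 ▸ hge) zero_le)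
    have hsub : deBlasi 𝕜 A - ENNReal.ofReal ε < wck 𝕜 A := by
      rw [hI A hA]
      exact ENNReal.sub_lt_self (deBlasi_ne_top hA) hpos hε'
    obtain ⟨x, hx, hxlt⟩ : ∃ x : ℕ → X, (∀ n, x n ∈ A) ∧
        deBlasi 𝕜 A - ENNReal.ofReal ε < clusterDist 𝕜 x := by
      simpa [wck, lt_iSup_iff] using hsub
    have hlt : deBlasi 𝕜 A < clusterDist 𝕜 x + ENNReal.ofReal ε :=
      (ENNReal.sub_lt_iff_lt_right ENNReal.ofReal_ne_top hge).1 hxlt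
    refine ⟨range x, range_subset_iff.2 hx, countable_range x, fun _ =>
      infinite_range_of_clusterDist_ne_zero (𝕜 := 𝕜) (pos_of_gt hxlt).ne', fun C' hC' hinf' => ?_⟩
    have hfreq : ∃ᶠ n in atTop, x n ∈ C' := by
      rw [Nat.frequently_atTop_iff_infinite]
      intro hf
      exact hinf' ((hf.image x).subset fun c hc => by
        obtain ⟨n, rfl⟩ := hC' hc
        exact ⟨n, hc, rfl⟩)
    obtain ⟨φ, hφ, hmem⟩ := extraction_of_frequently_atTop hfreq
    refine hlt.trans_le ?_
    gcongr
    exact ((clusterDist_le_comp x hφ.tendsto_atTop).trans (clusterDist_le_wck hmem)).trans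
      (wck_le_deBlasi (hA.subset (hC'.trans (range_subset_iff.2 hx))))

end Limits

/-! ### Weak sequential compactness, `ℓ¹` lower bounds, and (b). -/

section Sequences

variable {𝕜 : Type*} [RCLike 𝕜] {X : Type*} [NormedAddCommGroup X] [NormedSpace 𝕜 X]

theorem mem_of_weak_limit {α : Type*} {U : Filter α} [U.NeBot] {p : Submodule 𝕜 X}
    (hp : IsClosed (p : Set X)) {y : α → X} (hy : ∀ n, y n ∈ p) {l : X}
    (h : ∀ f : StrongDual 𝕜 X, Tendsto (fun n => f (y n)) U (𝓝 (f l))) : l ∈ p := by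
  by_contra hl
  have hne : p.mkQ l ≠ 0 := by simpa using hl
  obtain ⟨f, hf⟩ := SeparatingDual.exists_ne_zero (R := 𝕜) hne
  refine hf ?_
  have hy0 : ∀ n, p.mkQ (y n) = 0 := fun n => by simpa using hy n
  have := h (f.comp p.mkQL)
  refine tendsto_nhds_unique (f := fun n => f (p.mkQ (y n))) (l := U) this ?_
  simp only [hy0, map_zero]
  exact tendsto_const_nhds

/-- Take norming functionals of a dense sequence `e`: if all vanish at `v`, then `‖e n‖ ≤ ‖e n -
v‖`, which is absurd for `e n` close to `v ≠ 0`. -/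
theorem exists_separating_seq {s : Set X} (hs : TopologicalSpace.IsSeparable s) :
    ∃ f : ℕ → StrongDual 𝕜 X, (∀ n, ‖f n‖ ≤ 1) ∧ ∀ v ∈ s, (∀ n, f n v = 0) → v = 0 := by
  obtain ⟨c, hc, hsc⟩ := hs
  rcases c.eq_empty_or_nonempty with rfl | hne
  · exact ⟨0, by simp, fun v hv => by simp at hsc; simp [hsc] at hv⟩
  obtain ⟨e, rfl⟩ := hc.exists_eq_range hne
  choose f hf hfe using fun n => exists_dual_vector'' 𝕜 (e n)
  refine ⟨f, hf, fun v hv h0 => ?_⟩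
  by_contra hv0
  obtain ⟨_, ⟨n, rfl⟩, hn⟩ := Metric.mem_closure_iff.1 (hsc hv) (‖v‖ / 2) (by positivity)
  have h1 : ‖e n‖ ≤ ‖e n - v‖ := by
    have := (f n).le_of_opNorm_le (hf n) (e n - v)
    rw [map_sub, h0, hfe, sub_zero, one_mul] at this
    simpa using this
  rw [dist_comm, dist_eq_norm] at hn
  have h2 : ‖v‖ ≤ ‖e n‖ + ‖e n - v‖ := norm_sub_rev v (e n) ▸ norm_le_norm_add_norm_sub' v (e n)
  linarith

/-- A form of the Eberlein-Shmulian theorem. -/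
theorem exists_weakly_convergent_subseq {y : ℕ → X} (hb : Bornology.IsBounded (range y))
    (h : ∀ U : Ultrafilter ℕ, (U : Filter ℕ) ≤ atTop →
      ∃ l : X, ∀ f : StrongDual 𝕜 X, Tendsto (fun n => f (y n)) U (𝓝 (f l))) :
    ∃ φ : ℕ → ℕ, StrictMono φ ∧ IsWeaklyConvergent 𝕜 (y ∘ φ) := by
  set p : Submodule 𝕜 X := (Submodule.span 𝕜 (range y)).topologicalClosure with hp
  have hpc : IsClosed (p : Set X) := Submodule.isClosed_topologicalClosure _
  have hyp : ∀ n, y n ∈ p := fun n =>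
    Submodule.le_topologicalClosure _ (Submodule.subset_span (mem_range_self n))
  have hsep : TopologicalSpace.IsSeparable (p : Set X) :=
    (countable_range y).isSeparable.span.closure
  obtain ⟨f, hf, hf0⟩ := exists_separating_seq (𝕜 := 𝕜) hsep
  obtain ⟨r, hr⟩ := hb.exists_norm_le
  have hmem : ∀ n, (fun i => f i (y n)) ∈ (univ : Set ℕ).pi
      fun _ => Metric.closedBall (0 : 𝕜) r := fun n i _ => by
    have := (f i).le_of_opNorm_le (hf i) (y n)
    rw [one_mul] at this
    simpa using this.trans (hr _ (mem_range_self n))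
  -- Along `φ` every `f i` converges. The weak ultrafilter limits lie in `p`, where the `f i`
  -- separate points, so they all coincide.
  obtain ⟨a, -, φ, hφ, hlim⟩ := (isCompact_univ_pi fun _ =>
    isCompact_closedBall (0 : 𝕜) r).tendsto_subseq hmem
  have hlim' : ∀ i, Tendsto (fun n => f i (y (φ n))) atTop (𝓝 (a i)) := tendsto_pi_nhds.1 hlim
  have key : ∀ U : Ultrafilter ℕ, (U : Filter ℕ) ≤ atTop → ∃ l ∈ p, (∀ i, f i l = a i) ∧
      ∀ g : StrongDual 𝕜 X, Tendsto (fun n => g (y (φ n))) U (𝓝 (g l)) := fun U hU => by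
    obtain ⟨l, hl⟩ := h (U.map φ) ((map_mono hU).trans hφ.tendsto_atTop)
    have hl' : ∀ g : StrongDual 𝕜 X, Tendsto (fun n => g (y (φ n))) U (𝓝 (g l)) :=
      fun g => tendsto_map'_iff.1 (hl g)
    exact ⟨l, mem_of_weak_limit hpc (fun n => hyp (φ n)) hl',
      fun i => tendsto_nhds_unique (hl' (f i)) ((hlim' i).mono_left hU), hl'⟩
  obtain ⟨l, hlp, hla, -⟩ := key (hyperfilter ℕ) Nat.hyperfilter_le_atTop
  refine ⟨φ, hφ, l, tendsto_toWeakSpace_iff.2 fun g => ?_⟩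
  refine (tendsto_iff_ultrafilter _ _ _).2 fun U hU => ?_
  obtain ⟨l', hlp', hla', hl'⟩ := key U hU
  have : l' - l = 0 := hf0 _ (p.sub_mem hlp' hlp) fun i => by rw [map_sub, hla, hla', sub_self]
  rw [← sub_eq_zero.1 this]
  exact hl' g

theorem le_infEDist {F : Bidual 𝕜 X} {r : ℝ}
    (h : ∀ x : X, r ≤ ‖F - inclusionInDoubleDual 𝕜 X x‖) :
    ENNReal.ofReal r ≤ Metric.infEDist F (canonicalImage 𝕜 X) := by
  refine Metric.le_infEDist.2 ?_
  rintro _ ⟨x, rfl⟩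
  rw [edist_dist, dist_eq_norm]
  exact ENNReal.ofReal_le_ofReal (h x)

/-- The lower bound says exactly that the prescribed values define a functional of norm at most 1 on
the span; extend it by Hahn-Banach. -/
theorem exists_dual_of_l1_lower_bound {z : ℕ → X} {q : ℝ} (hq : 0 ≤ q)
    (hz : ∀ (n : ℕ) (α : ℕ → 𝕜),
      q * ∑ j ∈ Finset.range n, ‖α j‖ * ‖z j‖ ≤ ‖∑ j ∈ Finset.range n, α j • z j‖)
    {s : ℕ → 𝕜} (hs : ∀ j, ‖s j‖ ≤ 1) :
    ∃ f : StrongDual 𝕜 X, ‖f‖ ≤ 1 ∧ ∀ j, f (z j) = s j * ((q * ‖z j‖ : ℝ) : 𝕜) := by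
  let T := Finsupp.linearCombination 𝕜 z
  let g := Finsupp.linearCombination 𝕜 fun j => s j * ((q * ‖z j‖ : ℝ) : 𝕜)
  have hgT : ∀ α, ‖g α‖ ≤ ‖T α‖ := fun α => by
    obtain ⟨n, hn⟩ : ∃ n, α.support ⊆ Finset.range n := α.support.exists_nat_subset_range
    have hT : T α = ∑ j ∈ Finset.range n, α j • z j := by
      rw [Finsupp.linearCombination_apply]
      exact Finsupp.sum_of_support_subset _ hn _ (by simp)
    have hg : g α = ∑ j ∈ Finset.range n, α j • (s j * ((q * ‖z j‖ : ℝ) : 𝕜)) := by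
      rw [Finsupp.linearCombination_apply]
      exact Finsupp.sum_of_support_subset _ hn _ (by simp)
    rw [hT, hg]
    refine le_trans ?_ (hz n α)
    rw [Finset.mul_sum]
    refine (norm_sum_le _ _).trans (Finset.sum_le_sum fun j _ => ?_)
    rw [norm_smul, norm_mul, RCLike.norm_ofReal, abs_of_nonneg (by positivity)]
    calc ‖α j‖ * (‖s j‖ * (q * ‖z j‖)) ≤ ‖α j‖ * (1 * (q * ‖z j‖)) := by
          gcongr
          exact hs j
      _ = q * (‖α j‖ * ‖z j‖) := by ring
  -- `T` need not be injective, as some `z j` may vanish; by `hgT` the value of `g` does not depend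
  -- on the preimage chosen by `S`.
  obtain ⟨S, hS⟩ := T.rangeRestrict.exists_rightInverse_of_surjective T.range_rangeRestrict
  have hTS : ∀ v : T.range, T (S v) = v := fun v => congrArg Subtype.val (LinearMap.congr_fun hS v)
  let f₀ : StrongDual 𝕜 T.range := (g.comp S).mkContinuous 1 fun v => by
    have := hgT (S v)
    rw [hTS] at this
    simpa using this
  obtain ⟨f, hf, hfn⟩ := exists_extension_norm_eq T.range f₀
  refine ⟨f, hfn ▸ LinearMap.mkContinuous_norm_le _ zero_le_one _, fun j => ?_⟩
  have hzj : T (Finsupp.single j 1) = z j := by simp [T]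
  let v : T.range := ⟨z j, ⟨_, hzj⟩⟩
  have h1 : f (z j) = g (S v) := hf v
  have h2 : g (S v - Finsupp.single j 1) = 0 := by
    have := hgT (S v - Finsupp.single j 1)
    rw [map_sub T, hTS, hzj, sub_self, norm_zero] at this
    exact norm_le_zero_iff.1 this
  rw [h1, sub_eq_zero.1 ((map_sub g _ _).symm.trans h2)]
  simp [g]

/-- Signs that are negative on an initial segment of varying length produce functionals which
show that cluster points of an `ℓ¹`-like sequence are far from the space. -/
theorem le_norm_sub_of_l1_lower_bound {z : ℕ → X} {q t : ℝ} (hq : 0 ≤ q)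
    (hz : ∀ (n : ℕ) (α : ℕ → 𝕜),
      q * ∑ j ∈ Finset.range n, ‖α j‖ * ‖z j‖ ≤ ‖∑ j ∈ Finset.range n, α j • z j‖)
    (ht : ∀ᶠ k in atTop, t ≤ ‖z k‖) {U : Ultrafilter ℕ} (hU : (U : Filter ℕ) ≤ atTop)
    {F : Bidual 𝕜 X} (hF : ∀ f : StrongDual 𝕜 X, Tendsto (fun n => f (z n)) U (𝓝 (F f))) (x : X) :
    q * t ≤ ‖F - inclusionInDoubleDual 𝕜 X x‖ := by
  choose f hf hfz using fun m : ℕ => exists_dual_of_l1_lower_bound hq hz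
    (s := fun k => if k ≤ m then (-1 : 𝕜) else 1) (fun k => by split_ifs <;> simp)
  obtain ⟨g, hg, hlim⟩ := exists_weakStar_limit hf U
  have hgz : ∀ k, g (z k) = -((q * ‖z k‖ : ℝ) : 𝕜) := fun k => by
    refine tendsto_nhds_unique (hlim (z k)) (tendsto_const_nhds.congr' ?_)
    filter_upwards [hU (eventually_ge_atTop k)] with m hm
    simp [hfz, show k ≤ m from hm]
  have hre : ∀ h : StrongDual 𝕜 X, Tendsto (fun n => RCLike.re (h (z n))) U
      (𝓝 (RCLike.re (F h))) := fun h => (RCLike.continuous_re.tendsto _).comp (hF h)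
  have h1 : ∀ m, q * t ≤ RCLike.re (F (f m)) := fun m => by
    refine ge_of_tendsto (hre (f m)) ?_
    filter_upwards [hU (eventually_gt_atTop m), hU ht] with k hk htk
    rw [hfz, if_neg (not_le.2 hk), one_mul, RCLike.ofReal_re]
    gcongr
  have h2 : RCLike.re (F g) ≤ -(q * t) := by
    refine le_of_tendsto (hre g) ?_
    filter_upwards [hU ht] with k htk
    rw [hgz, map_neg, RCLike.ofReal_re]
    gcongr
  set D := F - inclusionInDoubleDual 𝕜 X x with hD
  have hbd : ∀ h : StrongDual 𝕜 X, ‖h‖ ≤ 1 → |RCLike.re (F h) - RCLike.re (h x)| ≤ ‖D‖ :=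
    fun h hh => by
      have e : D h = F h - h x := rfl
      rw [← map_sub, ← e]
      exact (RCLike.abs_re_le_norm _).trans ((D.le_opNorm h).trans
        (mul_le_of_le_one_right (norm_nonneg _) hh))
  -- `F` is at least `q * t` on each `f m` but at most `-(q * t)` on their limit `g`, whereas `x`
  -- acts weak-star continuously. Adding `h3` and `h4` cancels `re (g x)`.
  have h3 : q * t - RCLike.re (g x) ≤ ‖D‖ := by
    refine le_of_tendsto (tendsto_const_nhds.sub
      ((RCLike.continuous_re.tendsto _).comp (hlim x))) (Eventually.of_forall fun m => ?_)
    have := (le_abs_self _).trans (hbd (f m) (hf m))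
    simp only [Function.comp]
    linarith [h1 m]
  have h4 := (neg_le_abs _).trans (hbd g hg)
  linarith

theorem SubsequenceSplitting.propertyI (hS : SubsequenceSplitting 𝕜 X) (hII : PropertyII 𝕜 X) :
    PropertyI 𝕜 X := by
  intro A hA
  refine le_antisymm (wck_le_deBlasi hA) (not_lt.1 fun hlt => ?_)
  have hω := deBlasi_ne_top (𝕜 := 𝕜) hA
  have hw : wck 𝕜 A ≠ ∞ := hlt.ne_top
  have hinf : A.Infinite := fun hfin => by
    refine hlt.not_ge ?_
    refine ((deBlasi_le (K := A) (hfin.image _).isCompact).trans ?_).trans zero_le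
    exact iSup₂_le fun a ha => (Metric.infEDist_zero_of_mem ha).le
  set o := (deBlasi 𝕜 A).toReal with ho
  set w := (wck 𝕜 A).toReal with hwr
  have hwo : w < o := (ENNReal.toReal_lt_toReal hw hω).2 hlt
  have hw0 : 0 ≤ w := ENNReal.toReal_nonneg
  obtain ⟨ε, hε, hε1, hεw⟩ : ∃ ε : ℝ, 0 < ε ∧ ε < 1 ∧ w < (1 - ε) * (o - ε) := by
    have h1o : 0 < 1 + o := by linarith
    -- With this `ε`, `(1 - ε)(o - ε) = o - ε(1 + o) + ε² ≥ (o + w) / 2`.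
    refine ⟨(o - w) / (2 * (1 + o)), by apply div_pos <;> linarith, ?_, ?_⟩
    · rw [div_lt_one (by linarith)]
      linarith
    · have : (o - w) / (2 * (1 + o)) * (1 + o) = (o - w) / 2 := by field_simp
      nlinarith [sq_nonneg ((o - w) / (2 * (1 + o)))]
  obtain ⟨C, hCA, -, hCinf, hC⟩ := hII A hA ε hε
  let e := (hCinf hinf).natEmbedding
  have hxA : ∀ n, (e n : X) ∈ A := fun n => hCA (e n).2
  obtain ⟨φ, hφ, y, z, hx, ⟨l, hl⟩, hz⟩ := hS (fun n => (e n : X))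
    (hA.subset (range_subset_iff.2 hxA)) ε hε
  have ht : ∀ᶠ k in atTop, o - ε ≤ ‖z k‖ := by
    by_contra hcon
    have hfreq : ∃ᶠ k in atTop, ‖z k‖ < o - ε := by
      simpa only [not_eventually, not_le] using hcon
    have hpos : 0 ≤ o - ε := by
      obtain ⟨k, hk⟩ := hfreq.exists
      exact (norm_nonneg _).trans hk.le
    have hC'inf : ((fun k => (e (φ k) : X)) '' {k | ‖z k‖ < o - ε}).Infinite :=
      (Nat.frequently_atTop_iff_infinite.1 hfreq).image
        ((Subtype.val_injective.comp (e.injective.comp hφ.injective)).injOn)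
    have hlt' := hC _ (by rintro _ ⟨k, -, rfl⟩; exact (e (φ k)).2) hC'inf
    have hK : IsWeaklyCompact 𝕜 (insert l (range y)) := by
      have := hl.isCompact_insert_range
      rwa [range_comp' (toWeakSpace 𝕜 X) y, ← image_insert_eq] at this
    have hle : deBlasi 𝕜 ((fun k => (e (φ k) : X)) '' {k | ‖z k‖ < o - ε}) ≤
        ENNReal.ofReal (o - ε) := by
      refine (deBlasi_le hK).trans (iSup₂_le ?_)
      rintro _ ⟨k, hk, rfl⟩
      refine (Metric.infEDist_le_edist_of_mem
        (mem_insert_of_mem _ (mem_range_self k))).trans ?_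
      have hzk : (e (φ k) : X) - y k = z k := by rw [hx, add_sub_cancel_left]
      rw [edist_dist, dist_eq_norm, hzk]
      exact ENNReal.ofReal_le_ofReal (le_of_lt hk)
    have := hlt'.trans_le (add_le_add_left hle _)
    rw [← ENNReal.ofReal_add hpos hε.le, sub_add_cancel, ENNReal.ofReal_toReal hω] at this
    exact lt_irrefl _ this
  have hcd : ENNReal.ofReal ((1 - ε) * (o - ε)) ≤ clusterDist 𝕜 fun k => (e (φ k) : X) := by
    refine le_clusterDist fun U F hU hF => le_infEDist fun p => ?_
    have hG : ∀ f : StrongDual 𝕜 X, Tendsto (fun n => f (z n)) U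
        (𝓝 ((F - inclusionInDoubleDual 𝕜 X l) f)) := fun f => by
      have := (hF f).sub ((tendsto_toWeakSpace_iff.1 hl f).mono_left hU)
      simpa [hx] using this
    have := le_norm_sub_of_l1_lower_bound (by linarith) hz ht hU hG (p - l)
    rwa [map_sub, sub_sub_sub_cancel_right] at this
  have := hcd.trans (clusterDist_le_wck (A := A) fun k => hxA (φ k))
  rw [ENNReal.ofReal_le_iff_le_toReal hw] at this
  linarith

end Sequences

/-! ### Extraction of `ℓ¹` subsequences from the bidual, and (c). -/

section Splitting

variable {𝕜 : Type*} [RCLike 𝕜] {X : Type*} [NormedAddCommGroup X] [NormedSpace 𝕜 X]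

/-- If every large `n` failed, normalized bad coefficients would converge along `U`, giving `x +
β'F` of norm at most `r'`. But `hb` and `hs` bound this norm below by `r` times the total
coefficient mass, which is 1. -/
theorem exists_insert_l1_lower_bound {z : ℕ → X} {U : Ultrafilter ℕ} (hU : (U : Filter ℕ) ≤ atTop)
    {F : Bidual 𝕜 X} (hF : ∀ f : StrongDual 𝕜 X, Tendsto (fun n => f (z n)) U (𝓝 (F f)))
    {b : ℝ} (hb : ∀ (x : X) (a : 𝕜), ‖x‖ + b * ‖a‖ ≤ ‖inclusionInDoubleDual 𝕜 X x + a • F‖)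
    {s : Finset ℕ} {r r' : ℝ} (hrb : r ≤ b) (hr : r' < r)
    (hs : ∀ a : ℕ → 𝕜, r * ∑ j ∈ s, ‖a j‖ ≤ ‖∑ j ∈ s, a j • z j‖) :
    ∃ n, (∀ j ∈ s, j < n) ∧
      ∀ a : ℕ → 𝕜, r' * ∑ j ∈ insert n s, ‖a j‖ ≤ ‖∑ j ∈ insert n s, a j • z j‖ := by
  by_contra! hcon
  have hex : ∀ n, ∃ (a : ℕ → 𝕜) (β : 𝕜), (∀ j ∈ s, j < n) →
      ‖β‖ + ∑ j ∈ s, ‖a j‖ = 1 ∧ ‖β • z n + ∑ j ∈ s, a j • z j‖ ≤ r' := fun n => by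
    by_cases hn : ∀ j ∈ s, j < n
    · obtain ⟨a, ha⟩ := hcon n hn
      have hns : n ∉ s := fun h => lt_irrefl n (hn n h)
      rw [Finset.sum_insert hns, Finset.sum_insert hns] at ha
      set S := ‖a n‖ + ∑ j ∈ s, ‖a j‖ with hS
      have hS0 : 0 ≤ S := by positivity
      have hSpos : 0 < S := hS0.lt_of_ne fun h0 => by
        rw [← h0, mul_zero] at ha
        exact (norm_nonneg _).not_gt ha
      have hnorm : ‖((S⁻¹ : ℝ) : 𝕜)‖ = S⁻¹ := by
        rw [RCLike.norm_ofReal, abs_of_nonneg (by positivity)]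
      refine ⟨fun j => ((S⁻¹ : ℝ) : 𝕜) * a j, ((S⁻¹ : ℝ) : 𝕜) * a n, fun _ => ⟨?_, ?_⟩⟩
      · simp only [norm_mul, hnorm]
        rw [← Finset.mul_sum, ← mul_add, ← hS, inv_mul_cancel₀ hSpos.ne']
      · simp only [mul_smul]
        rw [← Finset.smul_sum, ← smul_add, norm_smul, hnorm]
        rw [inv_mul_le_iff₀ hSpos, mul_comm]
        exact ha.le
    · exact ⟨0, 0, fun h => absurd h hn⟩
  choose a β hab using hex
  have hev : ∀ᶠ n in (U : Filter ℕ), ∀ j ∈ s, j < n := hU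
    ((Finset.eventually_all s).2 fun j _ => eventually_gt_atTop j)
  have hlim : ∀ u : ℕ → 𝕜, (∀ᶠ n in (U : Filter ℕ), ‖u n‖ ≤ 1) →
      ∃ c, Tendsto u U (𝓝 c) := fun u hu => by
    obtain ⟨c, -, hc⟩ := (isCompact_closedBall (0 : 𝕜) 1).ultrafilter_le_nhds (U.map u)
      (le_principal_iff.2 <| Ultrafilter.mem_map.2 <| hu.mono fun n hn => by simpa using hn)
    exact ⟨c, hc⟩
  obtain ⟨β', hβ'⟩ := hlim β (hev.mono fun n hn => by
    rw [← (hab n hn).1]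
    exact le_add_of_nonneg_right (by positivity))
  have hA : ∀ j, ∃ c, j ∈ s → Tendsto (fun n => a n j) U (𝓝 c) := fun j => by
    by_cases hj : j ∈ s
    · obtain ⟨c, hc⟩ := hlim (fun n => a n j) (hev.mono fun n hn => by
        rw [← (hab n hn).1]
        exact (Finset.single_le_sum (f := fun j => ‖a n j‖) (fun _ _ => norm_nonneg _) hj).trans
          (le_add_of_nonneg_left (norm_nonneg _)))
      exact ⟨c, fun _ => hc⟩
    · exact ⟨0, fun h => absurd h hj⟩
  choose A hA using hA
  have hsum : ‖β'‖ + ∑ j ∈ s, ‖A j‖ = 1 := by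
    refine tendsto_nhds_unique (hβ'.norm.add (tendsto_finsetSum s fun j hj => (hA j hj).norm))
      (tendsto_const_nhds.congr' (hev.mono fun n hn => (hab n hn).1.symm))
  have hle : ‖inclusionInDoubleDual 𝕜 X (∑ j ∈ s, A j • z j) + β' • F‖ ≤ r' := by
    refine norm_le_of_limit (U := (U : Filter ℕ)) (hev.mono fun n hn => (hab n hn).2) fun f => ?_
    have := (hβ'.mul (hF f)).add
      (tendsto_finsetSum s fun j hj => (hA j hj).mul_const (f (z j)))
    simpa [add_comm] using this
  have h1 := (hb (∑ j ∈ s, A j • z j) β').trans hle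
  have h2 := hs A
  have h3 : r * ‖β'‖ ≤ b * ‖β'‖ := by gcongr
  have h4 : r * (‖β'‖ + ∑ j ∈ s, ‖A j‖) = r := by rw [hsum, mul_one]
  linarith

theorem exists_l1_subseq {z : ℕ → X} {U : Ultrafilter ℕ} (hU : (U : Filter ℕ) ≤ atTop)
    {F : Bidual 𝕜 X} (hF : ∀ f : StrongDual 𝕜 X, Tendsto (fun n => f (z n)) U (𝓝 (F f)))
    {b b' : ℝ} (hb : ∀ (x : X) (a : 𝕜), ‖x‖ + b * ‖a‖ ≤ ‖inclusionInDoubleDual 𝕜 X x + a • F‖)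
    (hbb : b' < b) :
    ∃ φ : ℕ → ℕ, StrictMono φ ∧ ∀ (n : ℕ) (α : ℕ → 𝕜),
      b' * ∑ j ∈ Finset.range n, ‖α j‖ ≤ ‖∑ j ∈ Finset.range n, α j • z (φ j)‖ := by
  -- Each insertion costs a strict decrease of the constant; this sequence falls from `b` but never
  -- below `b'`.
  let r : ℕ → ℝ := fun k => b' + (b - b') / (k + 1)
  have hpos : 0 < b - b' := sub_pos.2 hbb
  have hr0 : ∀ k, b' ≤ r k := fun k => le_add_of_nonneg_right (by positivity)
  have hrb : ∀ k, r k ≤ b := fun k => by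
    have : (b - b') / ((k : ℝ) + 1) ≤ b - b' :=
      div_le_self hpos.le (le_add_of_nonneg_left k.cast_nonneg)
    simp only [r]
    linarith
  have hrlt : ∀ k, r (k + 1) < r k := fun k => by
    simp only [r]
    push_cast
    gcongr
    linarith
  let G : Finset ℕ → ℝ → Prop := fun s t =>
    ∀ a : ℕ → 𝕜, t * ∑ j ∈ s, ‖a j‖ ≤ ‖∑ j ∈ s, a j • z j‖
  have step : ∀ k (s : {s // G s (r k)}), ∃ n, (∀ j ∈ s.1, j < n) ∧ G (insert n s.1) (r (k + 1)) :=
    fun k s => exists_insert_l1_lower_bound hU hF hb (hrb k) (hrlt k) s.2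
  choose N hN hNG using step
  let st : ∀ k, {s // G s (r k)} := fun k =>
    Nat.rec ⟨∅, fun a => by simp⟩ (fun k s => ⟨insert (N k s) s.1, hNG k s⟩) k
  let φ : ℕ → ℕ := fun k => N k (st k)
  have hst : ∀ k, (st (k + 1)).1 = insert (φ k) (st k).1 := fun k => rfl
  have hφ : StrictMono φ := strictMono_nat_of_lt_succ fun k =>
    hN (k + 1) (st (k + 1)) _ (by rw [hst]; exact Finset.mem_insert_self _ _)
  have himg : ∀ k, (st k).1 = (Finset.range k).image φ := fun k => by
    induction k with
    | zero => rfl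
    | succ k ih => rw [hst, ih, Finset.range_add_one, Finset.image_insert]
  refine ⟨φ, hφ, fun n α => ?_⟩
  have h := (st n).2 fun i => α (Function.invFun φ i)
  rw [himg, Finset.sum_image hφ.injective.injOn, Finset.sum_image hφ.injective.injOn] at h
  simp only [Function.leftInverse_invFun hφ.injective _] at h
  refine le_trans ?_ h
  gcongr
  exact hr0 n

theorem exists_strictMono_comp (h : ℕ → ℕ) (hh : ∀ m, ¬∃ᶠ n in atTop, h n = m) :
    ∃ χ : ℕ → ℕ, StrictMono χ ∧ StrictMono (h ∘ χ) := by
  refine strictMono_subseq_of_tendsto_atTop (tendsto_atTop.2 fun m => ?_)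
  have : ∀ᶠ n in atTop, ∀ k ∈ Finset.range m, h n ≠ k :=
    (Finset.eventually_all _).2 fun k _ => not_frequently.1 (hh k)
  filter_upwards [this] with n hn
  by_contra hlt
  exact hn (h n) (Finset.mem_range.2 (not_le.1 hlt)) rfl

/-- An index of `v` used infinitely often by `w` would make a point of `X` a cluster point. So each
index recurs finitely often, and thinning makes the indices increase. -/
theorem exists_subseq_clusterDist_le {v w : ℕ → X} (hw : ∀ n, w n ∈ range v)
    (h0 : clusterDist 𝕜 w ≠ 0) :
    ∃ ψ : ℕ → ℕ, StrictMono ψ ∧ clusterDist 𝕜 w ≤ clusterDist 𝕜 (v ∘ ψ) := by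
  choose h hh using hw
  obtain ⟨χ, hχ, hχ'⟩ := exists_strictMono_comp h fun m hm =>
    h0 (clusterDist_eq_zero (a := v m) (hm.mono fun n hn => by rw [← hh, hn]))
  refine ⟨h ∘ χ, hχ', ?_⟩
  have : v ∘ (h ∘ χ) = w ∘ χ := funext fun n => hh (χ n)
  rw [this]
  exact clusterDist_le_comp w hχ.tendsto_atTop

/-- In an L-embedded space, an element of the bidual that is far from `X` relative to its norm
is almost orthogonal to `X` in the sense of `ℓ¹`. -/
theorem IsLEmbedded.le_norm_add_smul (hL : IsLEmbedded 𝕜 X) {G : Bidual 𝕜 X} {M d : ℝ}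
    (hM : ‖G‖ ≤ M) (hd : ∀ x : X, d ≤ ‖G - inclusionInDoubleDual 𝕜 X x‖) (x : X) (a : 𝕜) :
    ‖x‖ + (2 * d - M) * ‖a‖ ≤ ‖inclusionInDoubleDual 𝕜 X x + a • G‖ := by
  obtain ⟨P, hPP, hP, hn⟩ := hL
  have hPx : P (inclusionInDoubleDual 𝕜 X x) = inclusionInDoubleDual 𝕜 X x := by
    obtain ⟨H, hH⟩ : inclusionInDoubleDual 𝕜 X x ∈ range P := hP ▸ mem_canonicalImage x
    rw [← hH, hPP]
  obtain ⟨p, hp⟩ : P G ∈ canonicalImage 𝕜 X := hP ▸ mem_range_self G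
  have hd' : d ≤ ‖G - P G‖ := hp ▸ hd p
  have hsplit := hn (inclusionInDoubleDual 𝕜 X x + a • G)
  rw [map_add, map_smul, hPx, add_sub_add_left_eq_sub, ← smul_sub, norm_smul] at hsplit
  -- Together with `hsplit` this leaves the coefficient `‖G - P G‖ - ‖P G‖` of `‖a‖`, and `‖P G‖ ≤ M
  -- - ‖G - P G‖`.
  have h1 : ‖x‖ ≤ ‖inclusionInDoubleDual 𝕜 X x + a • P G‖ + ‖a‖ * ‖P G‖ := by
    rw [← norm_inclusionInDoubleDual (𝕜 := 𝕜), ← norm_smul]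
    exact norm_le_add_norm_add _ _
  have h2 := hn G
  nlinarith [norm_nonneg a]

theorem exists_weak_limit_of_near {K : Set X} (hK : IsWeaklyCompact 𝕜 K) {x y : ℕ → X}
    (hx : Bornology.IsBounded (range x)) {r : ℝ} (hr : ∀ n, ‖x n - y n‖ ≤ r)
    (hy : ∀ n, y n ∈ K) : ∃ φ : ℕ → ℕ, StrictMono φ ∧ IsWeaklyConvergent 𝕜 (y ∘ φ) := by
  obtain ⟨M, hM⟩ := hx.exists_norm_le
  refine exists_weakly_convergent_subseq ?_ fun U _ => ?_
  · refine isBounded_iff_forall_norm_le.2 ⟨M + r, ?_⟩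
    rintro _ ⟨n, rfl⟩
    have := norm_sub_norm_le (y n) (x n)
    rw [norm_sub_rev] at this
    linarith [hr n, hM _ (mem_range_self n)]
  · obtain ⟨l, -, hl⟩ := hK.exists_limit (U := U) (y := y) (Eventually.of_forall hy)
    exact ⟨l, hl⟩

theorem exists_splitting_of_pos (hL : IsLEmbedded 𝕜 X) (hI : PropertyI 𝕜 X) {v : ℕ → X}
    (hv : Bornology.IsBounded (range v)) {c : ℝ} (hc : 0 < c) {ε : ℝ} (hε : 0 < ε) (hε1 : ε ≤ 1)
    (hlb : ENNReal.ofReal c ≤ deBlasi 𝕜 (range v))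
    (hub : deBlasi 𝕜 (range v) < ENNReal.ofReal (c + ε * c / 8)) :
    ∃ φ : ℕ → ℕ, StrictMono φ ∧ ∃ y z : ℕ → X,
      (∀ k, v (φ k) = y k + z k) ∧ IsWeaklyConvergent 𝕜 y ∧
      ∀ (n : ℕ) (α : ℕ → 𝕜),
        (1 - ε) * ∑ j ∈ Finset.range n, ‖α j‖ * ‖z j‖ ≤ ‖∑ j ∈ Finset.range n, α j • z j‖ := by
  -- Chosen so that `2(c - η) - (c + η) = c - 3η` exceeds `(1 - ε)(c + η)`: indeed `4η = εc / 2`.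
  set η := ε * c / 8 with hη
  have hη0 : 0 < η := by positivity
  have hηc : η < c := by
    have : ε * c ≤ c := mul_le_of_le_one_left hc.le hε1
    linarith
  obtain ⟨w, hw, hwlt⟩ : ∃ w : ℕ → X, (∀ n, w n ∈ range v) ∧
      ENNReal.ofReal (c - η) < clusterDist 𝕜 w := by
    have : ENNReal.ofReal (c - η) < wck 𝕜 (range v) := by
      rw [hI _ hv]
      exact ((ENNReal.ofReal_lt_ofReal_iff hc).2 (by linarith)).trans_le hlb
    simpa only [wck, lt_iSup_iff, exists_prop] using this
  obtain ⟨ψ, hψ, hwψ⟩ := exists_subseq_clusterDist_le hw (pos_of_gt hwlt).ne'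
  obtain ⟨K, hK, hKlt⟩ := exists_excess_lt hub
  have hnear : ∀ n, ∃ k ∈ K, ‖v (ψ n) - k‖ ≤ c + η := fun n => by
    obtain ⟨k, hk, hlt⟩ := Metric.infEDist_lt_iff.1
      ((infEDist_le_excess (mem_range_self (ψ n))).trans_lt hKlt)
    rw [edist_dist, dist_eq_norm] at hlt
    exact ⟨k, hk, ((ENNReal.ofReal_lt_ofReal_iff (by positivity)).1 hlt).le⟩
  choose y hyK hy using hnear
  have hvψ : Bornology.IsBounded (range (v ∘ ψ)) := hv.subset (range_comp_subset_range ψ v)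
  obtain ⟨θ, hθ, l, hl⟩ := exists_weak_limit_of_near hK hvψ hy hyK
  have hU := Nat.hyperfilter_le_atTop
  obtain ⟨F, hF⟩ := exists_cluster (𝕜 := 𝕜) (U := hyperfilter ℕ)
    (hvψ.subset (range_comp_subset_range θ (v ∘ ψ)))
  have hG : ∀ f : StrongDual 𝕜 X, Tendsto (fun n => f (v (ψ (θ n)) - y (θ n))) (hyperfilter ℕ)
      (𝓝 ((F - inclusionInDoubleDual 𝕜 X l) f)) := fun f => by
    simpa using (hF f).sub ((tendsto_toWeakSpace_iff.1 hl f).mono_left hU)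
  have hGn : ‖F - inclusionInDoubleDual 𝕜 X l‖ ≤ c + η :=
    norm_le_of_limit (U := (hyperfilter ℕ : Filter ℕ)) (Eventually.of_forall fun n => hy (θ n)) hG
  have hFd : ∀ p : X, c - η ≤ ‖F - inclusionInDoubleDual 𝕜 X l - inclusionInDoubleDual 𝕜 X p‖ :=
    fun p => by
      have := ((hwlt.le.trans hwψ).trans (clusterDist_le_comp (v ∘ ψ) hθ.tendsto_atTop)).trans
        ((clusterDist_le hU hF).trans
          (Metric.infEDist_le_edist_of_mem (mem_canonicalImage (l + p))))
      rw [edist_dist, dist_eq_norm, map_add, ← sub_sub,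
        ENNReal.ofReal_le_ofReal_iff (norm_nonneg _)] at this
      exact this
  obtain ⟨σ, hσ, hbd⟩ := exists_l1_subseq hU hG (b' := (1 - ε) * (c + η))
    (hL.le_norm_add_smul hGn hFd) (by nlinarith)
  refine ⟨ψ ∘ θ ∘ σ, hψ.comp (hθ.comp hσ), fun k => y (θ (σ k)),
    fun k => v (ψ (θ (σ k))) - y (θ (σ k)), fun k => by simp, ⟨l, hl.comp hσ.tendsto_atTop⟩,
    fun n α => le_trans ?_ (hbd n α)⟩
  -- The uniform bound with `c + η` gives the weighted one, since `‖z j‖ ≤ c + η`.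
  rw [mul_assoc, Finset.mul_sum _ _ (c + η)]
  refine mul_le_mul_of_nonneg_left (Finset.sum_le_sum fun j _ => ?_) (by linarith)
  rw [mul_comm]
  gcongr
  exact hy (θ (σ j))

/-- Cluster points of a diagonal subsequence have distance 0 from `X`, which is closed in the bidual
by completeness. -/
theorem exists_weakly_convergent_subseq_of_deBlasi [CompleteSpace X] {x : ℕ → X}
    (hx : Bornology.IsBounded (range x))
    (h : ∀ φ : ℕ → ℕ, StrictMono φ → ∀ c : ℝ≥0∞, 0 < c →
      ∃ ψ : ℕ → ℕ, StrictMono ψ ∧ deBlasi 𝕜 (range (x ∘ φ ∘ ψ)) < c) :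
    ∃ φ : ℕ → ℕ, StrictMono φ ∧ IsWeaklyConvergent 𝕜 (x ∘ φ) := by
  choose ψ hψ hlt using fun (k : ℕ) (φ : {φ : ℕ → ℕ // StrictMono φ}) =>
    h φ.1 φ.2 ((k : ℝ≥0∞) + 1)⁻¹ (by simp)
  let Φ : ℕ → {φ : ℕ → ℕ // StrictMono φ} := fun k =>
    Nat.rec ⟨id, strictMono_id⟩ (fun k φ => ⟨φ.1 ∘ ψ k φ, φ.2.comp (hψ k φ)⟩) k
  have hΦ : ∀ k, (Φ (k + 1)).1 = (Φ k).1 ∘ ψ k (Φ k) := fun k => rfl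
  let D : ℕ → ℕ := fun k => (Φ k).1 k
  have hD : StrictMono D := strictMono_nat_of_lt_succ fun k => by
    have : D (k + 1) = (Φ k).1 (ψ k (Φ k) (k + 1)) := rfl
    rw [this]
    exact (Φ k).2 ((Nat.lt_succ_self k).trans_le (hψ k (Φ k)).le_apply)
  have hrange : ∀ k m, k ≤ m → range (Φ m).1 ⊆ range (Φ k).1 := fun k m hkm => by
    induction m, hkm using Nat.le_induction with
    | base => exact Subset.rfl
    | succ m _ ih =>
      rw [hΦ]
      exact (range_comp_subset_range _ _).trans ih
  have hxD : Bornology.IsBounded (range (x ∘ D)) := hx.subset (range_comp_subset_range D x)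
  obtain ⟨θ, hθ, hconv⟩ := exists_weakly_convergent_subseq (𝕜 := 𝕜) hxD fun U hU => by
    obtain ⟨F, hF⟩ := exists_cluster (𝕜 := 𝕜) (U := U) hxD
    have hdist : ∀ k : ℕ, Metric.infEDist F (canonicalImage 𝕜 X) ≤ ((k : ℝ≥0∞) + 1)⁻¹ :=
      fun k => by
        obtain ⟨K, hK, hKlt⟩ := exists_excess_lt (hlt k (Φ k))
        refine infEDist_le_of_limit hK ?_ hF
        -- Stage `k` refines `Φ k` to `Φ (k + 1)`, so the bound at `k` holds on the diagonal only
        -- from index `k + 1` on.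
        filter_upwards [hU (eventually_ge_atTop (k + 1))] with m hm
        obtain ⟨i, hi⟩ := hrange (k + 1) m hm (mem_range_self m)
        have hmem : (x ∘ D) m ∈ range (x ∘ (Φ k).1 ∘ ψ k (Φ k)) := ⟨i, congrArg x hi⟩
        exact (infEDist_le_excess hmem).trans_lt hKlt
    have hzero : Metric.infEDist F (canonicalImage 𝕜 X) = 0 := by
      have hlim : Tendsto (fun k : ℕ => ((k : ℝ≥0∞) + 1)⁻¹) atTop (𝓝 0) := by
        simpa [Function.comp_def] using
          ENNReal.tendsto_inv_nat_nhds_zero.comp (tendsto_add_atTop_nat 1)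
      exact le_antisymm (ge_of_tendsto' hlim hdist) zero_le
    have hclosed : IsClosed (canonicalImage 𝕜 X) :=
      (inclusionInDoubleDualLi 𝕜 (E := X)).isometry.isClosedEmbedding.isClosed_range
    obtain ⟨l, rfl⟩ := (Metric.mem_iff_infEDist_zero_of_closed hclosed).2 hzero
    exact ⟨l, hF⟩
  exact ⟨D ∘ θ, hD.comp hθ, hconv⟩

theorem IsLEmbedded.subsequenceSplitting [CompleteSpace X] (hL : IsLEmbedded 𝕜 X)
    (hI : PropertyI 𝕜 X) : SubsequenceSplitting 𝕜 X := by
  -- Enlarging `ε` weakens the claim, so the factor `1 - ε` may be assumed nonnegative.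
  suffices hmain : ∀ x : ℕ → X, Bornology.IsBounded (range x) → ∀ ε : ℝ, 0 < ε → ε ≤ 1 →
      ∃ φ : ℕ → ℕ, StrictMono φ ∧ ∃ y z : ℕ → X,
      (∀ k, x (φ k) = y k + z k) ∧ IsWeaklyConvergent 𝕜 y ∧
      ∀ (n : ℕ) (α : ℕ → 𝕜),
        (1 - ε) * ∑ j ∈ Finset.range n, ‖α j‖ * ‖z j‖ ≤ ‖∑ j ∈ Finset.range n, α j • z j‖ by
    intro x hx ε hε
    obtain ⟨φ, hφ, y, z, hxy, hy, hz⟩ := hmain x hx (min ε 1) (lt_min hε one_pos) (min_le_right _ _)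
    refine ⟨φ, hφ, y, z, hxy, hy, fun n α => le_trans ?_ (hz n α)⟩
    gcongr
    exact min_le_left _ _
  intro x hx ε hε hε1
  by_cases hcase : ∀ φ : ℕ → ℕ, StrictMono φ → ∀ c : ℝ≥0∞, 0 < c →
      ∃ ψ : ℕ → ℕ, StrictMono ψ ∧ deBlasi 𝕜 (range (x ∘ φ ∘ ψ)) < c
  · obtain ⟨φ, hφ, hconv⟩ := exists_weakly_convergent_subseq_of_deBlasi hx hcase
    exact ⟨φ, hφ, x ∘ φ, 0, fun k => by simp, hconv, fun n α => by simp⟩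
  push Not at hcase
  obtain ⟨φ, hφ, c₀, hc₀, hlb⟩ := hcase
  -- A subsequence nearly attaining this infimum meets both bounds required by
  -- `exists_splitting_of_pos`.
  set c : ℝ≥0∞ := ⨅ (ψ : ℕ → ℕ) (_ : StrictMono ψ), deBlasi 𝕜 (range (x ∘ φ ∘ ψ)) with hc
  have hsub : ∀ ψ : ℕ → ℕ, Bornology.IsBounded (range (x ∘ φ ∘ ψ)) := fun ψ =>
    hx.subset (range_comp_subset_range _ x)
  have hc0 : c ≠ 0 := (hc₀.trans_le (le_iInf₂ hlb)).ne'
  have hct : c ≠ ∞ := ne_top_of_le_ne_top (deBlasi_ne_top (hsub id)) (iInf₂_le id strictMono_id)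
  have hcpos : 0 < c.toReal := ENNReal.toReal_pos hc0 hct
  obtain ⟨ψ, hψ, hlt⟩ : ∃ ψ : ℕ → ℕ, StrictMono ψ ∧
      deBlasi 𝕜 (range (x ∘ φ ∘ ψ)) < ENNReal.ofReal (c.toReal + ε * c.toReal / 8) := by
    have : c < ENNReal.ofReal (c.toReal + ε * c.toReal / 8) := by
      rw [ENNReal.lt_ofReal_iff_toReal_lt hct]
      exact lt_add_of_pos_right _ (by positivity)
    simpa only [hc, iInf_lt_iff, exists_prop] using this
  obtain ⟨σ, hσ, y, z, hxy, hy, hz⟩ := exists_splitting_of_pos hL hI (hsub ψ) hcpos hε hε1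
    (by rw [ENNReal.ofReal_toReal hct]; exact iInf₂_le ψ hψ) hlt
  exact ⟨φ ∘ ψ ∘ σ, hφ.comp (hψ.comp hσ), y, z, hxy, hy, hz⟩

end Splitting

end WeakNonCompactness

theorem proposition5p1 (𝕜 : Type*) [RCLike 𝕜] (X : Type*) [NormedAddCommGroup X]
    [NormedSpace 𝕜 X] [CompleteSpace X] :
    (WeakNonCompactness.PropertyI 𝕜 X → WeakNonCompactness.PropertyII 𝕜 X) ∧
    (WeakNonCompactness.SubsequenceSplitting 𝕜 X →
      WeakNonCompactness.PropertyII 𝕜 X → WeakNonCompactness.PropertyI 𝕜 X) ∧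
    (WeakNonCompactness.IsLEmbedded 𝕜 X →
      WeakNonCompactness.PropertyI 𝕜 X → WeakNonCompactness.SubsequenceSplitting 𝕜 X) := by
  exact ⟨fun h => h.propertyII, fun h => h.propertyI, fun h => h.subsequenceSplitting⟩
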